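/- Let $0<a<1$ and $0\le b<1$. For $x\in[0,1]$ put $f_-(x)=ax+b-\lfloor ax+b\rfloor$ and $f_+(x)=ax+b-(\lceil ax+b\rceil-1)$ (so $f_+(x)=f_-(x)$ unless $ax+b\in\mathbb Z$, when $f_-(x)=0$ and $f_+(x)=1$), and let $f_\pm(x)=\{f_-(x),f_+(x)\}$. An orbit of $f_\pm$ is a sequence $(x_n)_{n\ge0}$ with $x_0\in[0,1]$ and $x_{n+1}\in f_\pm(x_n)$ for all $n\ge0$. A universal limit cycle is a set $C=\{y_0,\dots,y_{q-1}\}$, where $q\ge1$ and $(y_n)_{n\ge0}$ is an orbit of $f_\pm$ with $y_{n+q}=y_n$ for all $n$, such that for every orbit $(x_n)$ of $f_\pm$ there is $j\ge0$ with $x_n-y_{j+n}\to0$ as $n\to\infty$. Let $F_-(x)=a(x-\lfloor x\rfloor)+b+\lfloor x\rfloor$ and $F_+(x)=ax+b-(1-a)\lfloor 1-x\rfloor$ for $x\in\mathbb R$. The rotation number of $f_\pm$ is the number $\rho\in[0,1)$ such that $F_-^n(x)/n\to\rho$ and $F_+^n(x)/n\to\rho$ as $n\to\infty$, for every $x\in\mathbb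 R$. For $x\in\mathbb R$ let $$\phi_\rho(x)=\frac{b}{1-a}+(1-a)\sum_{j=0}^\infty a^j\lfloor x-(j+1)\rho\rfloor .$$ **Theorem.** The rotation number $\rho$ of $f_\pm$ exists, and there is a probability measure $\mu$ such that for every orbit $(x_i)_{i\ge0}$ of $f_\pm$ the empirical measures $\frac1n\sum_{i=0}^{n-1}\delta_{x_i}$ converge weakly to $\mu$ as $n\to\infty$. Moreover: 1. if $\rho$ is rational, then $f_\pm$ has a universal limit cycle $C$, and $\mu$ is the uniform probability measure on $C$ (mass $1/|C|$ at each point); $C$ does not contain both $0$ and $1$, and $\mu$ is invariant under $f_-$ if $1\notin C$, and under $f_+$ if $0\notin C$; 2. if $\rho$ is irrational, then $\mu$ is the push-forward of Lebesgue measure on $[0,1]$ under $\phi_\rho$, and $\mu$ is invariant under both $f_-$ and $f_+$. -/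

import Mathlib

open MeasureTheory ProbabilityTheory Filter Topology

noncomputable section

/-- The right-continuous branch `f₋(x) = {ax + b}`, with the fractional part in `[0, 1)`. -/
def fMinus (a b x : ℝ) : ℝ := a * x + b - ⌊a * x + b⌋

/-- The left-continuous branch `f₊(x)`: it equals `f₋(x)` unless `ax + b` is an integer,
in which case it takes the value `1` instead of `0`. -/
def fPlus (a b x : ℝ) : ℝ := a * x + b - (⌈a * x + b⌉ - 1)

/-- The multi-valued map `f_±`. -/
def fPM (a b x : ℝ) : Set ℝ := {fMinus a b x, fPlus a b x}

/-- Orbits of `f_±` on `[0, 1]`; at the point of two values an arbitrary choice is allowed,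
at each visit anew. -/
def IsOrbit (a b : ℝ) (x : ℕ → ℝ) : Prop :=
  x 0 ∈ Set.Icc (0 : ℝ) 1 ∧ ∀ n, x (n + 1) ∈ fPM a b (x n)

/-- A periodic orbit of `f_±`, with period `q` (not necessarily the least one). -/
def IsPeriodicOrbit (a b : ℝ) (q : ℕ) (y : ℕ → ℝ) : Prop :=
  IsOrbit a b y ∧ 1 ≤ q ∧ ∀ n, y (n + q) = y n

/-- The finite set `C = {y₀, …, y_{q-1}}` of points of a periodic orbit of `f_±` is a universal
limit cycle: every orbit of `f_±` is asymptotic to a time shift of the periodic orbit. -/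
def IsUniversalLimitCycle (a b : ℝ) (C : Set ℝ) : Prop :=
  ∃ (q : ℕ) (y : ℕ → ℝ), IsPeriodicOrbit a b q y ∧ C = y '' Set.Iio q ∧
    ∀ x : ℕ → ℝ, IsOrbit a b x →
      ∃ j : ℕ, Tendsto (fun n => x n - y (j + n)) atTop (𝓝 0)

/-- The lift `F₋ : ℝ → ℝ` of `f₋`. -/
def liftMinus (a b x : ℝ) : ℝ := a * Int.fract x + b + ⌊x⌋

/-- The lift `F₊ : ℝ → ℝ` of `f₊`, the left-continuous version of `F₋`. -/
def liftPlus (a b x : ℝ) : ℝ := a * x + b - (1 - a) * ⌊1 - x⌋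

/-- `ρ ∈ [0, 1)` is the rotation number of `f_±`; it is unique, being a limit. -/
def IsRotationNumber (a b ρ : ℝ) : Prop :=
  ρ ∈ Set.Ico (0 : ℝ) 1 ∧ ∀ x : ℝ,
    Tendsto (fun n : ℕ => (liftMinus a b)^[n] x / n) atTop (𝓝 ρ) ∧
    Tendsto (fun n : ℕ => (liftPlus a b)^[n] x / n) atTop (𝓝 ρ)

/-- The function `φ_ρ`; for `0 < a < 1` the series converges absolutely. -/
def phi (a b ρ x : ℝ) : ℝ :=
  b / (1 - a) + (1 - a) * ∑' j : ℕ, a ^ j * (⌊x - (j + 1) * ρ⌋ : ℝ)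

/-- The empirical measure `(1/n) ∑_{i < n} δ_{x_i}` of the first `n ≥ 1` points of a sequence. -/
def empiricalMeasure (x : ℕ → ℝ) (n : ℕ) [NeZero n] : ProbabilityMeasure ℝ :=
  ⟨(n : ENNReal)⁻¹ • ∑ i ∈ Finset.range n, Measure.dirac (x i), ⟨by
    simp [ENNReal.inv_mul_cancel, NeZero.ne n]⟩⟩

end

/-! Subtracting the integers chosen along an orbit lifts it to `X n = x n + k n` with `X (n+1) = a *
X n + b + (1 - a) * k n`: an affine contraction driven only by the integers `k n`. The lifted orbit
stays between iterates of `F₊` and `F₋`, monotone degree-one maps with a common translation number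
`ρ`, so `k` follows a rotation: `k n ≤ n * ρ + c ≤ k n + 1` for some `c`. The function `φ_ρ` solves
the same recursion, with `⌊t⌋` as driver, along `t ↦ t + ρ`. Hence, once `k n = ⌊n * ρ + c⌋`, the
distance from `X n` to `φ_ρ (n * ρ + c)` shrinks by the factor `a` at each step, and `x n` is
asymptotic to `φ_ρ` of the fractional part of `n * ρ + c`. The floor can fail only when `n * ρ + c`
is an integer. For irrational `ρ` this happens at most once. For `ρ = p / q` it may recur with
period `q`, and the sign of `φ_ρ 0` decides which of the two choices persists once made; either way
the integers eventually have the form `⌊(n * p + r) / q⌋`. The limit measure then comes from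
averaging a periodic sequence, or from Weyl equidistribution pushed through `φ_ρ`, which is monotone
and so continuous almost everywhere. Invariance follows because `φ_ρ` carries the rotation to `x ↦ a
* x + b` modulo integers, which determines the branch away from the values 0 and 1. -/

/-! ### The series `φ_ρ` and its functional equation. -/

theorem summable_pow_mul_floor {a : ℝ} (ha0 : 0 < a) (ha1 : a < 1) (ρ x : ℝ) :
    Summable fun j : ℕ => a ^ j * (⌊x - (j + 1) * ρ⌋ : ℝ) := by
  have h0 : Summable fun j : ℕ => a ^ j := summable_geometric_of_lt_one ha0.le ha1
  have h1 : Summable fun j : ℕ => (j : ℝ) * a ^ j := by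
    simpa using summable_pow_mul_geometric_of_norm_lt_one 1
      (r := a) (by rw [Real.norm_of_nonneg ha0.le]; exact ha1)
  refine Summable.of_norm_bounded
    (g := fun j : ℕ => (|x| + |ρ| + 1) * a ^ j + |ρ| * ((j : ℝ) * a ^ j))
    ((h0.mul_left _).add (h1.mul_left _)) fun j => ?_
  have hj : (0 : ℝ) ≤ j := j.cast_nonneg
  have hfl : |(⌊x - (j + 1) * ρ⌋ : ℝ)| ≤ |x| + (j + 1) * |ρ| + 1 := by
    have h1 := Int.floor_le (x - (j + 1) * ρ)
    have h2 := Int.lt_floor_add_one (x - (j + 1) * ρ)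
    have h3 : |(j + 1) * ρ| = (j + 1) * |ρ| := by rw [abs_mul, abs_of_nonneg (by positivity)]
    have h4 := abs_le.1 (le_refl |x|)
    have h5 := abs_le.1 (le_refl |((j : ℝ) + 1) * ρ|)
    rw [h3] at h5
    exact abs_le.2 ⟨by linarith, by linarith⟩
  rw [norm_mul, Real.norm_of_nonneg (by positivity), Real.norm_eq_abs]
  calc a ^ j * |(⌊x - (j + 1) * ρ⌋ : ℝ)| ≤ a ^ j * (|x| + (j + 1) * |ρ| + 1) := by gcongr
    _ = _ := by ring

/-- The term `j = 0` at `x + ρ` is `⌊x⌋`, and the remaining terms are `a` times the series at `x`.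
-/
theorem phi_add_rotation {a b : ℝ} (ha0 : 0 < a) (ha1 : a < 1) (ρ x : ℝ) :
    phi a b ρ (x + ρ) = a * phi a b ρ x + b + (1 - a) * ⌊x⌋ := by
  have h1 : (1 - a) ≠ 0 := by linarith
  have key : ∑' j : ℕ, a ^ j * (⌊x + ρ - (j + 1) * ρ⌋ : ℝ)
      = ⌊x⌋ + a * ∑' j : ℕ, a ^ j * (⌊x - (j + 1) * ρ⌋ : ℝ) := by
    rw [(summable_pow_mul_floor ha0 ha1 ρ (x + ρ)).tsum_eq_zero_add, ← tsum_mul_left]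
    congr 1
    · simp
    · refine tsum_congr fun j => ?_
      rw [show x + ρ - (((j + 1 : ℕ) : ℝ) + 1) * ρ = x - (j + 1) * ρ by push_cast; ring]
      ring
  simp only [phi, key]
  generalize ∑' j : ℕ, a ^ j * (⌊x - (j + 1) * ρ⌋ : ℝ) = S
  field_simp
  ring

theorem phi_add_intCast {a b : ℝ} (ha0 : 0 < a) (ha1 : a < 1) (ρ x : ℝ) (m : ℤ) :
    phi a b ρ (x + m) = phi a b ρ x + m := by
  have h1 : (1 - a) ≠ 0 := by linarith
  have key : ∑' j : ℕ, a ^ j * (⌊x + m - (j + 1) * ρ⌋ : ℝ)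
      = ∑' j : ℕ, a ^ j * (⌊x - (j + 1) * ρ⌋ : ℝ) + (1 - a)⁻¹ * m := by
    rw [← tsum_geometric_of_lt_one ha0.le ha1, ← tsum_mul_right,
      ← (summable_pow_mul_floor ha0 ha1 ρ x).tsum_add
        ((summable_geometric_of_lt_one ha0.le ha1).mul_right _)]
    refine tsum_congr fun j => ?_
    rw [show x + m - ((j : ℝ) + 1) * ρ = x - (j + 1) * ρ + m by ring, Int.floor_add_intCast]
    push_cast
    ring
  simp only [phi, key]
  generalize ∑' j : ℕ, a ^ j * (⌊x - (j + 1) * ρ⌋ : ℝ) = S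
  field_simp
  ring

theorem phi_fract {a b : ℝ} (ha0 : 0 < a) (ha1 : a < 1) (ρ x : ℝ) :
    phi a b ρ (Int.fract x) = phi a b ρ x - ⌊x⌋ := by
  have h := phi_add_intCast (b := b) ha0 ha1 ρ (Int.fract x) ⌊x⌋
  rw [Int.fract_add_floor] at h
  linarith

theorem phi_monotone {a b : ℝ} (ha0 : 0 < a) (ha1 : a < 1) (ρ : ℝ) : Monotone (phi a b ρ) := by
  intro s t hst
  have h1 : 0 ≤ 1 - a := by linarith
  unfold phi
  gcongr
  · exact summable_pow_mul_floor ha0 ha1 ρ s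
  · exact summable_pow_mul_floor ha0 ha1 ρ t

/-- All summands are monotone, so one floor that jumps between `s` and `t` suffices. -/
theorem phi_lt_phi {a b ρ s t : ℝ} (ha0 : 0 < a) (ha1 : a < 1) (j : ℕ) (m : ℤ)
    (hs : s - (j + 1) * ρ < m) (ht : m ≤ t - (j + 1) * ρ) : phi a b ρ s < phi a b ρ t := by
  have h1 : 0 < 1 - a := by linarith
  have hst : s ≤ t := by linarith
  unfold phi
  gcongr
  refine Summable.tsum_lt_tsum (i := j) (fun i => by dsimp only; gcongr) ?_
    (summable_pow_mul_floor ha0 ha1 ρ s) (summable_pow_mul_floor ha0 ha1 ρ t)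
  have : ⌊s - (j + 1) * ρ⌋ < ⌊t - (j + 1) * ρ⌋ :=
    (Int.floor_lt.2 hs).trans_le (Int.le_floor.2 ht)
  gcongr

/-- One step of the dynamics along `φ_ρ`, up to an integer. -/
theorem exists_phi_fract_add_rotation {a b : ℝ} (ha0 : 0 < a) (ha1 : a < 1) (ρ t : ℝ) :
    ∃ d : ℤ, phi a b ρ (Int.fract (t + ρ)) = a * phi a b ρ (Int.fract t) + b - d := by
  refine ⟨⌊t + ρ⌋ - ⌊t⌋, ?_⟩
  rw [phi_fract ha0 ha1, phi_fract ha0 ha1, phi_add_rotation ha0 ha1]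
  push_cast
  ring

/-! ### Branches of `f_±` and integer codings of orbits. -/

theorem eq_fMinus {a b x u : ℝ} {d : ℤ} (h : u = a * x + b - d) (hu : u ∈ Set.Ico (0 : ℝ) 1) :
    u = fMinus a b x := by
  have : ⌊a * x + b⌋ = d := Int.floor_eq_iff.2 ⟨by linarith [hu.1], by linarith [hu.2]⟩
  rw [fMinus, this, h]

theorem eq_fPlus {a b x u : ℝ} {d : ℤ} (h : u = a * x + b - d) (hu : u ∈ Set.Ioc (0 : ℝ) 1) :
    u = fPlus a b x := by
  have : ⌈a * x + b⌉ = d + 1 :=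
    Int.ceil_eq_iff.2 ⟨by push_cast; linarith [hu.1], by push_cast; linarith [hu.2]⟩
  rw [fPlus, this, h]
  push_cast
  ring

theorem mem_fPM {a b x u : ℝ} {d : ℤ} (h : u = a * x + b - d) (hu : u ∈ Set.Icc (0 : ℝ) 1) :
    u ∈ fPM a b x := by
  rcases hu.2.lt_or_eq with h1 | h1
  · exact Or.inl (eq_fMinus h ⟨hu.1, h1⟩)
  · exact Or.inr (eq_fPlus h ⟨by linarith, hu.2⟩)

theorem fMinus_mem_Ico (a b x : ℝ) : fMinus a b x ∈ Set.Ico (0 : ℝ) 1 :=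
  ⟨Int.fract_nonneg _, Int.fract_lt_one _⟩

theorem fPlus_mem_Ioc (a b x : ℝ) : fPlus a b x ∈ Set.Ioc (0 : ℝ) 1 := by
  have h1 := Int.ceil_lt_add_one (a * x + b)
  have h2 := Int.le_ceil (a * x + b)
  unfold fPlus
  exact ⟨by linarith, by linarith⟩

/-- An orbit `x` together with integers `k n` such that `x n + k n` is an orbit of the lift. -/
structure IsCoding (a b : ℝ) (x : ℕ → ℝ) (k : ℕ → ℤ) : Prop where
  mem : ∀ n, x n ∈ Set.Icc (0 : ℝ) 1
  step : ∀ n, x (n + 1) = a * x n + b + k n - k (n + 1)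

theorem IsOrbit.exists_isCoding {a b : ℝ} {x : ℕ → ℝ} (hx : IsOrbit a b x) :
    ∃ k, IsCoding a b x k := by
  have hd : ∀ n, ∃ d : ℤ, x (n + 1) = a * x n + b - d := by
    intro n
    rcases hx.2 n with h | h
    · exact ⟨_, h⟩
    · exact ⟨⌈a * x n + b⌉ - 1, by rw [h, fPlus]; push_cast; ring⟩
  choose d hd using hd
  refine ⟨fun n => ∑ i ∈ Finset.range n, d i, ?_, ?_⟩
  · rintro (_ | n)
    · exact hx.1
    · rcases hx.2 n with h | h
      · rw [h]; exact Set.Ico_subset_Icc_self (fMinus_mem_Ico _ _ _)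
      · rw [h]; exact Set.Ioc_subset_Icc_self (fPlus_mem_Ioc _ _ _)
  · intro n
    rw [Finset.sum_range_succ, hd n]
    push_cast
    ring

theorem exists_isOrbit (a b : ℝ) : ∃ x, IsOrbit a b x := by
  refine ⟨fun n => (fMinus a b)^[n] 0, by simp, fun n => Or.inl ?_⟩
  dsimp only
  rw [Function.iterate_succ_apply']

/-! ### The two lifts and their common rotation number. -/

theorem liftMinus_eq (a b x : ℝ) : liftMinus a b x = a * x + b + (1 - a) * ⌊x⌋ := by
  rw [liftMinus, Int.fract]
  ring

/-- `F₋` as a monotone circle map lift. -/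
noncomputable def liftMinusLift {a : ℝ} (b : ℝ) (ha0 : 0 < a) (ha1 : a < 1) : CircleDeg1Lift where
  toFun := liftMinus a b
  monotone' s t hst := by
    have : 0 ≤ 1 - a := by linarith
    rw [liftMinus_eq, liftMinus_eq]
    gcongr
  map_add_one' s := by
    rw [liftMinus_eq, liftMinus_eq, Int.floor_add_one]
    push_cast
    ring

/-- `F₊` as a monotone circle map lift. -/
noncomputable def liftPlusLift {a : ℝ} (b : ℝ) (ha0 : 0 < a) (ha1 : a < 1) : CircleDeg1Lift where
  toFun := liftPlus a b
  monotone' s t hst := by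
    have : 0 ≤ 1 - a := by linarith
    rw [liftPlus, liftPlus]
    gcongr
  map_add_one' s := by
    rw [liftPlus, liftPlus, show 1 - (s + 1) = 1 - s - 1 by ring, Int.floor_sub_one]
    push_cast
    ring

theorem liftMinus_lt_liftPlus {a b s t : ℝ} (ha0 : 0 < a) (ha1 : a < 1) (hst : s < t) :
    liftMinus a b s < liftPlus a b t := by
  have h1 : 0 < 1 - a := by linarith
  have h2 : ⌊s⌋ ≤ -⌊1 - t⌋ := by
    have : ⌊s⌋ + ⌊1 - t⌋ < 1 := by
      have h3 := Int.floor_le s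
      have h4 := Int.floor_le (1 - t)
      have : (⌊s⌋ : ℝ) + ⌊1 - t⌋ < 1 := by linarith
      exact_mod_cast this
    omega
  have h2' : (⌊s⌋ : ℝ) ≤ -⌊1 - t⌋ := by exact_mod_cast h2
  rw [liftMinus_eq, liftPlus]
  nlinarith [mul_lt_mul_of_pos_left hst ha0, mul_le_mul_of_nonneg_left h2' h1.le]

theorem liftPlus_le_liftMinus {a b : ℝ} (ha1 : a < 1) (s : ℝ) :
    liftPlus a b s ≤ liftMinus a b s := by
  have h1 : 0 < 1 - a := by linarith
  have h2 : -⌊1 - s⌋ ≤ ⌊s⌋ := by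
    have : -1 < ⌊s⌋ + ⌊1 - s⌋ := by
      have h3 := Int.lt_floor_add_one s
      have h4 := Int.lt_floor_add_one (1 - s)
      have : (-1 : ℝ) < ⌊s⌋ + ⌊1 - s⌋ := by linarith
      exact_mod_cast this
    omega
  have h2' : -(⌊1 - s⌋ : ℝ) ≤ ⌊s⌋ := by exact_mod_cast h2
  rw [liftMinus_eq, liftPlus]
  nlinarith [mul_le_mul_of_nonneg_left h2' h1.le]

theorem iterate_liftMinus_lt_iterate_liftPlus {a b s t : ℝ} (ha0 : 0 < a) (ha1 : a < 1)
    (hst : s < t) (n : ℕ) : (liftMinus a b)^[n] s < (liftPlus a b)^[n] t := by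
  induction n with
  | zero => exact hst
  | succ n ih =>
    rw [Function.iterate_succ_apply', Function.iterate_succ_apply']
    exact liftMinus_lt_liftPlus ha0 ha1 ih

theorem tendsto_iterate_div {f : CircleDeg1Lift} (x : ℝ) :
    Tendsto (fun n : ℕ => f^[n] x / n) atTop (𝓝 f.translationNumber) := by
  have h := (f.tendsto_translationNumber x).add (tendsto_const_div_atTop_nhds_zero_nat x)
  rw [add_zero] at h
  refine h.congr fun n => ?_
  rw [CircleDeg1Lift.coe_pow]
  ring

/-- The iterates interlace: `F₊ ≤ F₋` everywhere, while `F₋ⁿ 0 < F₊ⁿ 1`, so the growth rates agree.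
-/
theorem translationNumber_liftPlus {a : ℝ} (b : ℝ) (ha0 : 0 < a) (ha1 : a < 1) :
    (liftPlusLift b ha0 ha1).translationNumber = (liftMinusLift b ha0 ha1).translationNumber := by
  apply le_antisymm
  · exact CircleDeg1Lift.translationNumber_mono fun x => liftPlus_le_liftMinus ha1 x
  · exact le_of_tendsto_of_tendsto' (tendsto_iterate_div 0) (tendsto_iterate_div 1) fun n => by
      gcongr
      exact (iterate_liftMinus_lt_iterate_liftPlus ha0 ha1 zero_lt_one n).le

theorem isRotationNumber_translationNumber {a b : ℝ} (ha0 : 0 < a) (ha1 : a < 1) (hb0 : 0 ≤ b)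
    (hb1 : b < 1) : IsRotationNumber a b (liftMinusLift b ha0 ha1).translationNumber := by
  refine ⟨⟨?_, ?_⟩, fun x => ⟨tendsto_iterate_div x, ?_⟩⟩
  · have := CircleDeg1Lift.le_translationNumber_of_add_int_le (liftMinusLift b ha0 ha1)
      (x := 0) (m := 0) (by change _ ≤ liftMinus a b 0; simpa [liftMinus] using hb0)
    simpa using this
  -- `F₋ x ≤ x + b`, since `⌊x⌋ ≤ x`; hence `ρ ≤ b < 1`.
  · refine lt_of_le_of_lt (CircleDeg1Lift.translationNumber_le_of_le_add _ (z := b) ?_) hb1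
    intro x
    change liftMinus a b x ≤ _
    rw [liftMinus_eq]
    nlinarith [Int.floor_le x]
  · rw [← translationNumber_liftPlus]
    exact tendsto_iterate_div x

/-! ### Orbits shadow a rotation. -/

namespace IsCoding

variable {a b : ℝ} {x : ℕ → ℝ} {k : ℕ → ℤ}

theorem lift_le (ha1 : a < 1) (h : IsCoding a b x k) (n : ℕ) :
    x (n + 1) + k (n + 1) ≤ liftMinus a b (x n + k n) := by
  have h1 : (0 : ℝ) ≤ 1 - a := by linarith
  have hk : (k n : ℝ) ≤ ⌊x n + k n⌋ := by
    exact_mod_cast Int.le_floor.2 (by linarith [(h.mem n).1])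
  rw [liftMinus_eq, h.step n]
  nlinarith [mul_le_mul_of_nonneg_left hk h1]

theorem le_lift (ha1 : a < 1) (h : IsCoding a b x k) (n : ℕ) :
    liftPlus a b (x n + k n) ≤ x (n + 1) + k (n + 1) := by
  have h1 : (0 : ℝ) ≤ 1 - a := by linarith
  have hk : ((-k n : ℤ) : ℝ) ≤ ⌊1 - (x n + k n)⌋ := by
    exact_mod_cast Int.le_floor.2 (by push_cast; linarith [(h.mem n).2])
  push_cast at hk
  rw [liftPlus, h.step n]
  nlinarith [mul_le_mul_of_nonneg_left hk h1]

/-- The lifted orbit lies below the iterates of `F₋` and above those of `F₊`. A displacement bound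
at one point bounds the translation number; the error 1 comes from `x m` and `x (m + n)` lying in
`[0, 1]`. -/
theorem rotation_bounds (ha0 : 0 < a) (ha1 : a < 1) (h : IsCoding a b x k) (m n : ℕ) :
    (k (m + n) - k m - 1 : ℝ) ≤ n * (liftMinusLift b ha0 ha1).translationNumber ∧
      n * (liftMinusLift b ha0 ha1).translationNumber ≤ k (m + n) - k m + 1 := by
  have hup : x (m + n) + k (m + n) ≤ (liftMinusLift b ha0 ha1)^[n] (x m + k m) := by
    induction n with
    | zero => exact le_rfl
    | succ n ih =>
      rw [Function.iterate_succ_apply', ← add_assoc]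
      exact (h.lift_le ha1 _).trans ((liftMinusLift b ha0 ha1).monotone ih)
  have hlow : (liftPlusLift b ha0 ha1)^[n] (x m + k m) ≤ x (m + n) + k (m + n) := by
    clear hup
    induction n with
    | zero => exact le_rfl
    | succ n ih =>
      rw [Function.iterate_succ_apply', ← add_assoc]
      exact ((liftPlusLift b ha0 ha1).monotone ih).trans
        (h.le_lift ha1 _)
  have hm := h.mem m
  have hmn := h.mem (m + n)
  constructor
  · have := CircleDeg1Lift.le_translationNumber_of_add_int_le ((liftMinusLift b ha0 ha1) ^ n)
      (x := x m + k m) (m := k (m + n) - k m - 1) (by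
        rw [CircleDeg1Lift.coe_pow]
        push_cast
        linarith [hm.2, hmn.1])
    rw [CircleDeg1Lift.translationNumber_pow] at this
    exact_mod_cast this
  · have := CircleDeg1Lift.translationNumber_le_of_le_add_int ((liftPlusLift b ha0 ha1) ^ n)
      (x := x m + k m) (m := k (m + n) - k m + 1) (by
        rw [CircleDeg1Lift.coe_pow]
        push_cast
        linarith [hm.1, hmn.2])
    rw [CircleDeg1Lift.translationNumber_pow, translationNumber_liftPlus] at this
    exact_mod_cast this

/-- The lifted orbit follows an orbit of the rigid rotation by `ρ`. -/
theorem exists_shift (ha0 : 0 < a) (ha1 : a < 1) (h : IsCoding a b x k) :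
    ∃ c : ℝ, ∀ n : ℕ, (k n : ℝ) ≤ n * (liftMinusLift b ha0 ha1).translationNumber + c ∧
      n * (liftMinusLift b ha0 ha1).translationNumber + c ≤ k n + 1 := by
  set ρ := (liftMinusLift b ha0 ha1).translationNumber
  have key : ∀ i j : ℕ, (k i - i * ρ : ℝ) ≤ k j + 1 - j * ρ := by
    intro i j
    rcases le_total i j with hij | hij
    · obtain ⟨n, rfl⟩ := Nat.exists_eq_add_of_le hij
      have := (h.rotation_bounds ha0 ha1 i n).2
      push_cast
      linarith
    · obtain ⟨n, rfl⟩ := Nat.exists_eq_add_of_le hij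
      have := (h.rotation_bounds ha0 ha1 j n).1
      push_cast
      linarith
  -- The least `c` satisfying the left inequalities; `key` makes the supremum finite and gives the
  -- right ones.
  refine ⟨⨆ i : ℕ, (k i - i * ρ : ℝ), fun n => ⟨?_, ?_⟩⟩
  · have := le_ciSup (f := fun i : ℕ => (k i - i * ρ : ℝ))
      ⟨k 0 + 1 - (0 : ℕ) * ρ, by rintro _ ⟨i, rfl⟩; exact key i 0⟩ n
    linarith
  · have := ciSup_le (f := fun i : ℕ => (k i - i * ρ : ℝ)) fun i => key i n
    linarith

/-- While the integer parts agree with those of the rotation, the distance to `φ_ρ` contracts. -/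
theorem sub_phi_eq (ha0 : 0 < a) (ha1 : a < 1) (h : IsCoding a b x k) (ρ c : ℝ) (n m : ℕ)
    (hk : ∀ i < m, k (n + i) = ⌊((n + i : ℕ) : ℝ) * ρ + c⌋) :
    x (n + m) + k (n + m) - phi a b ρ (((n + m : ℕ) : ℝ) * ρ + c) =
      a ^ m * (x n + k n - phi a b ρ (n * ρ + c)) := by
  induction m with
  | zero => simp
  | succ m ih =>
    have h1 := ih fun i hi => hk i (by omega)
    have h2 := hk m (by omega)
    rw [← add_assoc, h.step, show ((n + m + 1 : ℕ) : ℝ) * ρ + c = ((n + m : ℕ) : ℝ) * ρ + c + ρ by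
      push_cast; ring, phi_add_rotation ha0 ha1, ← h2, pow_succ', mul_assoc, ← h1]
    ring

theorem tendsto_sub_phi (ha0 : 0 < a) (ha1 : a < 1) (h : IsCoding a b x k) {ρ c : ℝ} {N : ℕ}
    (hk : ∀ n ≥ N, k n = ⌊(n : ℝ) * ρ + c⌋) :
    Tendsto (fun n : ℕ => x n - phi a b ρ (Int.fract (n * ρ + c))) atTop (𝓝 0) := by
  rw [← tendsto_add_atTop_iff_nat N]
  have h1 := (tendsto_pow_atTop_nhds_zero_of_lt_one ha0.le ha1).mul_const
    (x N + k N - phi a b ρ (N * ρ + c))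
  rw [zero_mul] at h1
  refine h1.congr fun m => ?_
  rw [← h.sub_phi_eq ha0 ha1 ρ c N m fun i _ => hk _ (by omega), phi_fract ha0 ha1, add_comm m N,
    hk (N + m) (by omega)]
  ring

end IsCoding

/-! ### The integer parts eventually agree with those of a rotation. -/

/-- Since `p` is invertible modulo `q`, some summand of the series jumps exactly at `i' / q`. -/
theorem phi_lt_phi_of_coprime {a b : ℝ} (ha0 : 0 < a) (ha1 : a < 1) {p : ℤ} {q : ℕ} (hq : 0 < q)
    (hpq : IsCoprime p (q : ℤ)) {i i' : ℤ} (hi : i < i') :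
    phi a b (p / q) (i / q) < phi a b (p / q) (i' / q) := by
  have hq' : (0 : ℝ) < q := by exact_mod_cast hq
  have hqz : (0 : ℤ) < q := by exact_mod_cast hq
  obtain ⟨u, v, huv⟩ := hpq
  -- `j + 1` is a positive solution of `(j + 1) * p ≡ i'` modulo `q`
  have hj0 : 0 ≤ (u * i' - 1) % q := Int.emod_nonneg _ hqz.ne'
  obtain ⟨j, hj⟩ := Int.eq_ofNat_of_zero_le hj0
  have hd : ((j : ℤ) + 1) * p = i' - q * (v * i' + (u * i' - 1) / q * p) := by
    have := Int.emod_add_mul_ediv (u * i' - 1) q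
    rw [hj] at this
    linear_combination p * this + i' * huv
  have hd' : ((j : ℝ) + 1) * p = i' - q * (v * i' + ((u * i' - 1) / q : ℤ) * p) := by
    exact_mod_cast hd
  refine phi_lt_phi ha0 ha1 j (v * i' + (u * i' - 1) / q * p) ?_ ?_
  · have : (i : ℝ) < i' := by exact_mod_cast hi
    rw [mul_div_assoc', hd', ← sub_div, div_lt_iff₀ hq']
    push_cast
    linarith
  · rw [mul_div_assoc', hd', ← sub_div, le_div_iff₀ hq']
    push_cast
    linarith

namespace IsCoding

variable {a b : ℝ} {x : ℕ → ℝ} {k : ℕ → ℤ}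

/-- Two integer values of `n * ρ + c` would make `ρ` rational, so past the only possible one the
bounds force the floor. -/
theorem eventually_eq_floor_of_irrational {ρ c : ℝ} (hρ : Irrational ρ)
    (hc : ∀ n : ℕ, (k n : ℝ) ≤ n * ρ + c ∧ n * ρ + c ≤ k n + 1) :
    ∃ N : ℕ, ∀ n ≥ N, k n = ⌊(n : ℝ) * ρ + c⌋ := by
  have key : ∀ n : ℕ, (∀ m : ℤ, (n : ℝ) * ρ + c ≠ m) → k n = ⌊(n : ℝ) * ρ + c⌋ := by
    intro n hn
    refine (Int.floor_eq_iff.2 ⟨(hc n).1, lt_of_le_of_ne (hc n).2 ?_⟩).symm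
    exact_mod_cast hn (k n + 1)
  by_cases h : ∃ (n₀ : ℕ) (m₀ : ℤ), (n₀ : ℝ) * ρ + c = m₀
  · obtain ⟨n₀, m₀, h₀⟩ := h
    refine ⟨n₀ + 1, fun n hn => key n fun m hm => ?_⟩
    have h1 := (hρ.natCast_mul (m := n - n₀) (by omega)).ne_int (m - m₀)
    apply h1
    rw [Nat.cast_sub (by omega)]
    push_cast
    linarith
  · push Not at h
    exact ⟨0, fun n _ => key n (h n)⟩

theorem floor_div_eq {q : ℕ} (hq : 0 < q) (p r k : ℤ) (n : ℕ) :
    k = ⌊(n : ℝ) * (p / q) + r / q⌋ ↔ q * k ≤ n * p + r ∧ n * p + r < q * k + q := by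
  have hq' : (0 : ℝ) < q := by exact_mod_cast hq
  rw [eq_comm, Int.floor_eq_iff, show (n : ℝ) * (p / q) + r / q = (n * p + r) / q by ring,
    le_div_iff₀ hq', div_lt_iff₀ hq']
  refine and_congr ?_ ?_
  · rw [mul_comm]; exact_mod_cast Iff.rfl
  · rw [show ((k : ℝ) + 1) * q = q * k + q by ring]; exact_mod_cast Iff.rfl

/-- If `c = r / q`, each time `n * ρ + c` is an integer it may equal `k n` or `k n + 1`. One choice,
selected by the sign of `φ_ρ 0`, reproduces itself after `q` steps: it either never occurs or occurs
at every such time from some point on. Phase `r` encodes the first choice, phase `r - 1` the second.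
-/
theorem eventually_eq_floor_of_rational (ha0 : 0 < a) (ha1 : a < 1) (h : IsCoding a b x k)
    {p : ℤ} {q : ℕ} (hq : 0 < q) (hpq : IsCoprime p (q : ℤ)) {c : ℝ}
    (hc : ∀ n : ℕ, (k n : ℝ) ≤ n * (p / q : ℝ) + c ∧ n * (p / q : ℝ) + c ≤ k n + 1) :
    ∃ (r : ℤ) (N : ℕ), ∀ n ≥ N, k n = ⌊(n : ℝ) * (p / q) + r / q⌋ := by
  have hq' : (0 : ℝ) < q := by exact_mod_cast hq
  have hqz : (0 : ℤ) < q := by exact_mod_cast hq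
  have haq : a ^ q < 1 := pow_lt_one₀ ha0.le ha1 hq.ne'
  have haq0 : 0 < a ^ q := pow_pos ha0 q
  by_cases hr : ∃ r : ℤ, c = r / q
  swap
  -- Here `n * ρ + c` is never an integer, and rounding `c` down to a multiple of `1 / q` leaves all
  -- the floors unchanged.
  · push Not at hr
    refine ⟨⌊q * c⌋, 0, fun n _ => ?_⟩
    have h1 : (⌊q * c⌋ : ℝ) / q < c := by
      refine lt_of_le_of_ne ?_ (hr _).symm
      rw [div_le_iff₀ hq', mul_comm c]
      exact Int.floor_le _
    refine (Int.floor_eq_iff.2 ⟨?_, by linarith [(hc n).2]⟩).symm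
    have h2 : q * k n - n * p ≤ ⌊q * c⌋ := by
      apply Int.le_floor.2
      have := mul_le_mul_of_nonneg_left (hc n).1 hq'.le
      rw [mul_add, mul_left_comm, mul_div_cancel₀ _ hq'.ne'] at this
      push_cast
      linarith
    have h2' : (q : ℝ) * k n - n * p ≤ ⌊q * c⌋ := by exact_mod_cast h2
    rw [show (n : ℝ) * (p / q) + ⌊q * c⌋ / q = (n * p + ⌊q * c⌋) / q by ring, le_div_iff₀ hq']
    linarith
  obtain ⟨r, rfl⟩ := hr
  have hle : ∀ n : ℕ, q * k n ≤ n * p + r := by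
    intro n
    have := (hc n).1
    rw [show (n : ℝ) * (p / q) + r / q = (n * p + r) / q by ring, le_div_iff₀ hq', mul_comm] at this
    exact_mod_cast this
  have hge : ∀ n : ℕ, n * p + r ≤ q * k n + q := by
    intro n
    have := (hc n).2
    rw [show (n : ℝ) * (p / q) + r / q = (n * p + r) / q by ring, div_le_iff₀ hq',
      show ((k n : ℝ) + 1) * q = q * k n + q by ring] at this
    exact_mod_cast this
  have hdvd : ∀ (n i : ℕ) (u v : ℤ), n * p + r = q * u → ((n + i : ℕ) : ℤ) * p + r = q * v →
      q ∣ i := by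
    intro n i u v hu hv
    have : (q : ℤ) ∣ i * p := ⟨v - u, by push_cast at hv; linear_combination hv - hu⟩
    exact_mod_cast hpq.symm.dvd_of_dvd_mul_right this
  by_cases h0 : 0 < phi a b (p / q) 0
  · by_cases hn₀ : ∃ n₀ : ℕ, n₀ * p + r = q * k n₀
    swap
    · push Not at hn₀
      refine ⟨r - 1, 0, fun n _ => (floor_div_eq hq p _ _ n).2 ?_⟩
      have := hn₀ n
      have := hle n
      have := hge n
      omega
    obtain ⟨n₀, hn₀⟩ := hn₀
    have step : ∀ n : ℕ, n * p + r = q * k n → ((n + q : ℕ) : ℤ) * p + r = q * k (n + q) := by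
      intro n hn
      have hn' : (n : ℝ) * p + r = q * k n := by exact_mod_cast hn
      -- Between times `n` and `n + q` no integer is met, so contraction applies over the whole
      -- period.
      have h1 := h.sub_phi_eq ha0 ha1 (p / q) (r / q) n q fun i hi => by
        refine (floor_div_eq hq p _ _ _).2 ⟨hle _, lt_of_le_of_ne (hge _) fun he => ?_⟩
        rcases Nat.eq_zero_or_pos i with rfl | hi0
        · simp only [add_zero] at he
          omega
        · exact absurd (Nat.le_of_dvd hi0 (hdvd n i _ (k (n + i) + 1) hn (by rw [he]; ring)))
            (by omega)
      have e1 : (n : ℝ) * (p / q) + r / q = 0 + k n := by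
        rw [show (n : ℝ) * (p / q) + r / q = (n * p + r) / q by ring, hn']
        field_simp
        ring
      have e2 : ((n + q : ℕ) : ℝ) * (p / q) + r / q = 0 + ((k n + p : ℤ) : ℝ) := by
        push_cast
        rw [add_mul, mul_div_cancel₀ _ hq'.ne']
        linarith
      rw [e1, e2, phi_add_intCast ha0 ha1, phi_add_intCast ha0 ha1] at h1
      have hx := (h.mem n).1
      have hx' := (h.mem (n + q)).2
      -- The left-hand quantity equals `a ^ q * x n + (1 - a ^ q) * φ_ρ 0`; as `x (n + q) ≤ 1`, the
      -- lower choice is excluded at `n + q`.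
      have h3 : (0 : ℝ) < x (n + q) + k (n + q) - (k n + p : ℤ) := by
        nlinarith [mul_nonneg haq0.le hx, mul_pos h0 (sub_pos.2 haq)]
      have h4 : k n + p - 1 < k (n + q) := by
        have : ((k n + p - 1 : ℤ) : ℝ) < k (n + q) := by push_cast at h3 ⊢; linarith
        exact_mod_cast this
      have h5 := hle (n + q)
      have e3 : ((n + q : ℕ) : ℤ) * p + r = q * (k n + p) := by
        push_cast; linear_combination hn
      rw [e3] at h5 ⊢
      have h6 := le_of_mul_le_mul_left h5 hqz
      rw [le_antisymm h6 (by omega)]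
    have all : ∀ s : ℕ, ((n₀ + s * q : ℕ) : ℤ) * p + r = q * k (n₀ + s * q) := by
      intro s
      induction s with
      | zero => simpa using hn₀
      | succ s ih =>
        have := step _ ih
        rwa [show n₀ + s * q + q = n₀ + (s + 1) * q by ring] at this
    refine ⟨r, n₀, fun n hn => (floor_div_eq hq p _ _ _).2
      ⟨hle _, lt_of_le_of_ne (hge _) fun he => ?_⟩⟩
    obtain ⟨i, rfl⟩ := Nat.exists_eq_add_of_le hn
    obtain ⟨s, rfl⟩ := hdvd n₀ i _ (k (n₀ + i) + 1) hn₀ (by rw [he]; ring)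
    have := all s
    rw [mul_comm s q] at this
    omega
  -- Phase `r - 1` replaces the base point 0 by `-1 / q`, where strict growth of `φ_ρ` on multiples
  -- of `1 / q` makes the sign strict even if `φ_ρ 0 = 0`.
  · have hβ : phi a b (p / q) (((-1 : ℤ) : ℝ) / q) < 0 := by
      have := phi_lt_phi_of_coprime (b := b) ha0 ha1 hq hpq (i := -1) (i' := 0) (by norm_num)
      rw [Int.cast_zero, zero_div] at this
      exact this.trans_le (not_lt.1 h0)
    by_cases hn₀ : ∃ n₀ : ℕ, n₀ * p + r = q * (k n₀ + 1)
    swap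
    · push Not at hn₀
      refine ⟨r, 0, fun n _ => (floor_div_eq hq p _ _ n).2 ⟨hle _, lt_of_le_of_ne (hge _) ?_⟩⟩
      have := hn₀ n
      rwa [mul_add, mul_one] at this
    obtain ⟨n₀, hn₀⟩ := hn₀
    have step : ∀ n : ℕ, n * p + r = q * (k n + 1) →
        ((n + q : ℕ) : ℤ) * p + r = q * (k (n + q) + 1) := by
      intro n hn
      have hn' : (n : ℝ) * p + r = q * (k n + 1) := by exact_mod_cast hn
      have h1 := h.sub_phi_eq ha0 ha1 (p / q) ((r - 1 : ℤ) / q) n q fun i hi => by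
        have hne : ((n + i : ℕ) : ℤ) * p + r ≠ q * k (n + i) := fun he => by
          rcases Nat.eq_zero_or_pos i with rfl | hi0
          · simp only [add_zero] at he
            rw [hn, mul_add] at he
            omega
          · exact absurd (Nat.le_of_dvd hi0 (hdvd n i _ _ hn he)) (by omega)
        have := hle (n + i)
        have := hge (n + i)
        exact (floor_div_eq hq p _ _ _).2 (by omega)
      have e1 : (n : ℝ) * (p / q) + (r - 1 : ℤ) / q = ((-1 : ℤ) : ℝ) / q + (k n + 1 : ℤ) := by
        push_cast
        rw [show (n : ℝ) * (p / q) + (r - 1) / q = (n * p + r - 1) / q by ring, hn']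
        field_simp
        ring
      have e2 : ((n + q : ℕ) : ℝ) * (p / q) + (r - 1 : ℤ) / q =
          ((-1 : ℤ) : ℝ) / q + (k n + 1 + p : ℤ) := by
        rw [Nat.cast_add, add_mul, mul_div_cancel₀ _ hq'.ne']
        push_cast at e1 ⊢
        linarith
      rw [e1, e2, phi_add_intCast ha0 ha1, phi_add_intCast ha0 ha1] at h1
      have hx := (h.mem n).2
      have hx' := (h.mem (n + q)).1
      -- The left side equals `(1 - a ^ q) * φ_ρ (-1 / q) - a ^ q * (1 - x n)`.
      have h3 : x (n + q) + k (n + q) - (k n + 1 + p : ℤ) < 0 := by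
        push_cast at h1 ⊢
        nlinarith [mul_nonneg haq0.le (sub_nonneg.2 hx), mul_pos (neg_pos.2 hβ) (sub_pos.2 haq)]
      have h4 : k (n + q) < k n + 1 + p := by
        have : (k (n + q) : ℝ) < (k n + 1 + p : ℤ) := by linarith
        exact_mod_cast this
      have h5 := hge (n + q)
      have e3 : ((n + q : ℕ) : ℤ) * p + r = q * (k n + p + 1) := by
        push_cast; linear_combination hn
      rw [e3, show q * k (n + q) + q = q * (k (n + q) + 1) by ring] at h5
      have h6 := le_of_mul_le_mul_left h5 hqz
      rw [e3, show k (n + q) = k n + p by omega]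
    have all : ∀ s : ℕ, ((n₀ + s * q : ℕ) : ℤ) * p + r = q * (k (n₀ + s * q) + 1) := by
      intro s
      induction s with
      | zero => simpa using hn₀
      | succ s ih =>
        have := step _ ih
        rwa [show n₀ + s * q + q = n₀ + (s + 1) * q by ring] at this
    refine ⟨r - 1, n₀, fun n hn => (floor_div_eq hq p _ _ _).2 ?_⟩
    have hne : (n : ℤ) * p + r ≠ q * k n := fun he => by
      obtain ⟨i, rfl⟩ := Nat.exists_eq_add_of_le hn
      obtain ⟨s, rfl⟩ := hdvd n₀ i _ _ hn₀ he
      have := all s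
      rw [mul_comm s q, mul_add] at this
      omega
    have := hle n
    have := hge n
    omega

end IsCoding

/-! ### Weak convergence of empirical measures. -/

/-- The empirical measure of the first `n ≥ 1` points of a sequence in any measurable space. -/
noncomputable def empirical {X : Type*} [MeasurableSpace X] (x : ℕ → X) (n : ℕ) [NeZero n] :
    ProbabilityMeasure X :=
  ⟨(n : ENNReal)⁻¹ • ∑ i ∈ Finset.range n, Measure.dirac (x i), ⟨by
    simp [ENNReal.inv_mul_cancel, NeZero.ne n]⟩⟩

theorem map_empirical {X Y : Type*} [MeasurableSpace X] [MeasurableSpace Y] (x : ℕ → X) (n : ℕ)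
    [NeZero n] {f : X → Y} (hf : Measurable f) :
    (empirical x n).map hf.aemeasurable = empirical (f ∘ x) n := by
  apply Subtype.ext
  change Measure.map f _ = _
  simp only [empirical, ProbabilityMeasure.coe_mk]
  rw [Measure.map_smul, ← Measure.mapₗ_apply_of_measurable hf, map_sum]
  simp only [Measure.mapₗ_apply_of_measurable hf, Measure.map_dirac' hf, Function.comp]

theorem integral_empirical {X E : Type*} [MeasurableSpace X] [MeasurableSingletonClass X]
    [NormedAddCommGroup E] [NormedSpace ℝ E] [CompleteSpace E] (x : ℕ → X) (n : ℕ) [NeZero n]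
    (f : X → E) :
    ∫ t, f t ∂(empirical x n : Measure X) = (n : ℝ)⁻¹ • ∑ i ∈ Finset.range n, f (x i) := by
  simp only [empirical, ProbabilityMeasure.coe_mk]
  rw [integral_smul_measure, integral_finsetSum_measure fun i _ => integrable_dirac (by simp)]
  simp

/-- The mapping theorem for weak convergence along an almost everywhere continuous map. -/
theorem tendsto_map_of_ae_continuousAt {X Y : Type*} [MeasurableSpace X] [TopologicalSpace X]
    [HasOuterApproxClosed X] [OpensMeasurableSpace X] [MeasurableSpace Y] [PseudoEMetricSpace Y]
    [OpensMeasurableSpace Y] {μs : ℕ → ProbabilityMeasure X} {μ : ProbabilityMeasure X}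
    (h : Tendsto μs atTop (𝓝 μ)) {f : X → Y} (hf : Measurable f)
    (hc : ∀ᵐ x ∂(μ : Measure X), ContinuousAt f x) :
    Tendsto (fun n => (μs n).map hf.aemeasurable) atTop (𝓝 (μ.map hf.aemeasurable)) := by
  refine tendsto_of_forall_isOpen_le_liminf' fun G hG => ?_
  simp only [ProbabilityMeasure.toMeasure_map, Measure.map_apply hf hG.measurableSet]
  calc (μ : Measure X) (f ⁻¹' G) ≤ (μ : Measure X) (interior (f ⁻¹' G)) := by
        refine measure_mono_ae ?_
        filter_upwards [hc] with x hx hxG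
        exact mem_interior_iff_mem_nhds.2 (hx.preimage_mem_nhds (hG.mem_nhds hxG))
    _ ≤ atTop.liminf fun n => (μs n : Measure X) (interior (f ⁻¹' G)) :=
        ProbabilityMeasure.le_liminf_measure_open_of_tendsto h isOpen_interior
    _ ≤ _ := liminf_le_liminf (Eventually.of_forall fun n => measure_mono interior_subset)

/-- Asymptotic sequences have the same limit of empirical measures. -/
theorem tendsto_empirical_of_tendsto_sub {x y : ℕ → ℝ} {μ : ProbabilityMeasure ℝ}
    (hxy : Tendsto (fun n => x n - y n) atTop (𝓝 0))
    (hy : Tendsto (fun n : ℕ => empirical y (n + 1)) atTop (𝓝 μ)) :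
    Tendsto (fun n : ℕ => empirical x (n + 1)) atTop (𝓝 μ) := by
  rw [tendsto_iff_forall_lipschitz_integral_tendsto] at hy ⊢
  rintro f hb ⟨L, hL⟩
  have h1 : Tendsto (fun n => f (x n) - f (y n)) atTop (𝓝 0) := by
    refine squeeze_zero_norm (fun n => ?_) (by simpa using hxy.norm.const_mul (L : ℝ))
    simpa [Real.dist_eq] using hL.dist_le_mul (x n) (y n)
  have h2 := (hy f hb ⟨L, hL⟩).add ((tendsto_add_atTop_iff_nat 1).2 h1.cesaro)
  rw [add_zero] at h2
  refine h2.congr fun n => ?_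
  rw [integral_empirical, integral_empirical, Finset.sum_sub_distrib]
  simp only [smul_eq_mul]
  ring

/-- Birkhoff averages of a periodic sequence. -/
theorem tendsto_average_of_periodic {g : ℕ → ℝ} {q : ℕ} (hq : 0 < q)
    (hg : ∀ n, g (n + q) = g n) :
    Tendsto (fun n : ℕ => (n : ℝ)⁻¹ * ∑ i ∈ Finset.range n, g i) atTop
      (𝓝 ((q : ℝ)⁻¹ * ∑ i ∈ Finset.range q, g i)) := by
  have hq' : (q : ℝ) ≠ 0 := by exact_mod_cast hq.ne'
  set M := (q : ℝ)⁻¹ * ∑ i ∈ Finset.range q, g i with hM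
  set P : ℕ → ℝ := fun n => ∑ i ∈ Finset.range n, (g i - M) with hP
  -- Centred sums vanish over a full period, so the partial sums are periodic, hence bounded.
  have hPq : Function.Periodic P q := by
    intro n
    have h0 : P q = 0 := by
      simp only [hP, Finset.sum_sub_distrib, Finset.sum_const, Finset.card_range, nsmul_eq_mul, hM]
      rw [mul_inv_cancel_left₀ hq', sub_self]
    calc P (n + q) = P q + ∑ i ∈ Finset.range n, (g (q + i) - M) := by
          rw [add_comm]; exact Finset.sum_range_add _ _ _
      _ = P n := by
          rw [h0, zero_add]
          exact Finset.sum_congr rfl fun i _ => by rw [add_comm q i, hg]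
  have hbound : ∀ n, ‖P n‖ ≤ ∑ i ∈ Finset.range q, ‖P i‖ := by
    intro n
    rw [← hPq.map_mod_nat n]
    exact Finset.single_le_sum (f := fun i => ‖P i‖) (fun i _ => norm_nonneg _)
      (Finset.mem_range.2 (Nat.mod_lt n hq))
  have h0 : Tendsto (fun n : ℕ => (n : ℝ)⁻¹ * P n) atTop (𝓝 0) := by
    refine squeeze_zero_norm (a := fun n : ℕ => (n : ℝ)⁻¹ * ∑ i ∈ Finset.range q, ‖P i‖)
      (fun n => ?_) ?_
    · rw [norm_mul, norm_inv, Real.norm_natCast]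
      exact mul_le_mul_of_nonneg_left (hbound n) (by positivity)
    · simpa using tendsto_natCast_atTop_atTop.inv_tendsto_atTop.mul_const
        (∑ i ∈ Finset.range q, ‖P i‖)
  have h1 := h0.const_add M
  rw [add_zero] at h1
  refine h1.congr' ?_
  filter_upwards [eventually_gt_atTop 0] with n hn
  have hn' : (n : ℝ) ≠ 0 := by exact_mod_cast hn.ne'
  simp only [hP, Finset.sum_sub_distrib, Finset.sum_const, Finset.card_range, nsmul_eq_mul]
  rw [mul_sub, inv_mul_cancel_left₀ hn']
  ring

theorem tendsto_empirical_of_periodic {y : ℕ → ℝ} {q : ℕ} [NeZero q]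
    (hy : ∀ n, y (n + q) = y n) :
    Tendsto (fun n : ℕ => empirical y (n + 1)) atTop (𝓝 (empirical y q)) := by
  rw [tendsto_iff_forall_lipschitz_integral_tendsto]
  intro f _ _
  simp only [integral_empirical, smul_eq_mul]
  exact (tendsto_add_atTop_iff_nat 1).2 (tendsto_average_of_periodic (g := fun n => f (y n))
    (NeZero.pos q) fun n => by rw [hy])

/-! ### Weyl equidistribution. -/

theorem norm_geom_sum_le {z : ℂ} (hz : ‖z‖ = 1) (h1 : z ≠ 1) (n : ℕ) :
    ‖∑ i ∈ Finset.range n, z ^ i‖ ≤ 2 / ‖z - 1‖ := by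
  rw [geom_sum_eq h1, norm_div]
  gcongr
  refine (norm_sub_le _ _).trans ?_
  simp [hz]
  norm_num

theorem fourier_coe_ne_one {ρ : ℝ} (hρ : Irrational ρ) {m : ℤ} (hm : m ≠ 0) :
    fourier m (ρ : UnitAddCircle) ≠ (1 : ℂ) := by
  rw [fourier_coe_apply, Ne, Complex.exp_eq_one_iff]
  rintro ⟨n, hn⟩
  have h1 : (m : ℂ) * ρ = n := by
    have : (2 * Real.pi * Complex.I : ℂ) ≠ 0 := Complex.two_pi_I_ne_zero
    apply mul_left_cancel₀ this
    rw [Complex.ofReal_one, div_one] at hn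
    linear_combination hn
  exact (hρ.intCast_mul hm).ne_int n (by exact_mod_cast h1)

/-- Weyl's equidistribution theorem for continuous functions on the circle. -/
theorem tendsto_average_rotation {ρ : ℝ} (hρ : Irrational ρ) (c : ℝ) (f : C(UnitAddCircle, ℂ)) :
    Tendsto (fun n : ℕ => (n : ℝ)⁻¹ • ∑ i ∈ Finset.range n, f ((i * ρ + c : ℝ) : UnitAddCircle))
      atTop (𝓝 (∫ t, f t)) := by
  have hint : ∀ f : C(UnitAddCircle, ℂ), Integrable f := fun f =>
    f.continuous.integrable_of_hasCompactSupport (HasCompactSupport.of_compactSpace f)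
  -- The functions with the desired limit form a subspace. It contains the characters, by bounded
  -- geometric sums, and their span is uniformly dense.
  let S : Submodule ℂ C(UnitAddCircle, ℂ) :=
    { carrier := {f | Tendsto (fun n : ℕ => (n : ℝ)⁻¹ • ∑ i ∈ Finset.range n,
        f ((i * ρ + c : ℝ) : UnitAddCircle)) atTop (𝓝 (∫ t, f t))}
      zero_mem' := by simp
      add_mem' := by
        intro f g hf hg
        have h := Tendsto.add hf hg
        rw [← integral_add (hint f) (hint g)] at h
        refine h.congr fun n => ?_
        simp [Finset.sum_add_distrib]
      smul_mem' := by
        intro z f hf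
        have h := Tendsto.const_mul z hf
        rw [← integral_const_mul] at h
        refine h.congr fun n => ?_
        simp [← Finset.mul_sum]
        ring }
  have hspan : Submodule.span ℂ (Set.range (@fourier (1 : ℝ))) ≤ S := by
    rw [Submodule.span_le]
    rintro _ ⟨m, rfl⟩
    change Tendsto _ _ _
    rcases eq_or_ne m 0 with rfl | hm
    · simp only [fourier_zero, integral_const]
      refine tendsto_const_nhds.congr' ?_
      filter_upwards [eventually_gt_atTop 0] with n hn
      have hn' : (n : ℂ) ≠ 0 := by exact_mod_cast hn.ne'
      simp [hn', measureReal_def]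
    · have h0 : ∫ t : UnitAddCircle, fourier m t = (0 : ℂ) :=
        integral_eq_zero_of_add_right_eq_neg (fourier_add_half_inv_index hm zero_lt_one)
      rw [h0]
      set z : ℂ := fourier m (ρ : UnitAddCircle) with hz
      have hz1 : ‖z‖ = 1 := Circle.norm_coe _
      have hterm : ∀ i : ℕ, fourier m ((i * ρ + c : ℝ) : UnitAddCircle) =
          fourier m (c : UnitAddCircle) * z ^ i := by
        intro i
        rw [hz, fourier_coe_apply, fourier_coe_apply, fourier_coe_apply, ← Complex.exp_nat_mul,
          ← Complex.exp_add]
        congr 1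
        push_cast
        ring
      refine squeeze_zero_norm (a := fun n : ℕ => (n : ℝ)⁻¹ * (2 / ‖z - 1‖)) (fun n => ?_) ?_
      · simp only [hterm, ← Finset.mul_sum]
        rw [norm_smul, norm_mul, norm_inv, Real.norm_natCast,
          show ‖(fourier m (c : UnitAddCircle) : ℂ)‖ = 1 from Circle.norm_coe _, one_mul]
        exact mul_le_mul_of_nonneg_left
          (norm_geom_sum_le hz1 (fourier_coe_ne_one hρ hm) n) (by positivity)
      · simpa using tendsto_natCast_atTop_atTop.inv_tendsto_atTop.mul_const (2 / ‖z - 1‖)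
  have hf : f ∈ (Submodule.span ℂ (Set.range (@fourier (1 : ℝ)))).topologicalClosure := by
    rw [span_fourier_closure_eq_top]; trivial
  rw [Metric.tendsto_atTop]
  intro ε hε
  obtain ⟨g, hg, hfg⟩ := Metric.mem_closure_iff.1 hf (ε / 3) (by positivity)
  obtain ⟨N, hN⟩ := Metric.tendsto_atTop.1 (hspan hg) (ε / 3) (by positivity)
  have hpt : ∀ t, ‖f t - g t‖ ≤ ε / 3 := fun t => by
    rw [← dist_eq_norm]; exact (ContinuousMap.dist_apply_le_dist t).trans hfg.le
  refine ⟨N, fun n hn => ?_⟩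
  set A := (n : ℝ)⁻¹ • ∑ i ∈ Finset.range n, f ((i * ρ + c : ℝ) : UnitAddCircle)
  set B := (n : ℝ)⁻¹ • ∑ i ∈ Finset.range n, g ((i * ρ + c : ℝ) : UnitAddCircle)
  have h1 : dist A B ≤ ε / 3 := by
    rw [dist_eq_norm, ← smul_sub, ← Finset.sum_sub_distrib, norm_smul, norm_inv, Real.norm_natCast]
    have h2 : ‖∑ i ∈ Finset.range n, (f ((i * ρ + c : ℝ) : UnitAddCircle) -
        g ((i * ρ + c : ℝ) : UnitAddCircle))‖ ≤ n * (ε / 3) := by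
      refine (norm_sum_le _ _).trans ?_
      refine (Finset.sum_le_card_nsmul _ _ (ε / 3) fun i _ => hpt _).trans_eq ?_
      simp
    rcases Nat.eq_zero_or_pos n with rfl | hn0
    · simp; positivity
    · have hn' : (0 : ℝ) < n := by exact_mod_cast hn0
      rw [inv_mul_le_iff₀ hn']
      exact h2
  have h3 : dist (∫ t, g t) (∫ t, f t) ≤ ε / 3 := by
    rw [dist_eq_norm, ← integral_sub (hint g) (hint f)]
    refine (norm_integral_le_of_norm_le_const (C := ε / 3)
      (Eventually.of_forall fun t => by rw [norm_sub_rev]; exact hpt t)).trans_eq ?_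
    simp [measureReal_def]
  have h4 : dist B (∫ t, g t) < ε / 3 := hN n hn
  linarith [dist_triangle4 A B (∫ t, g t) (∫ t, f t)]

/-- Lebesgue measure on the unit circle as a probability measure. -/
noncomputable def circleVolume : ProbabilityMeasure UnitAddCircle := ⟨volume, ⟨UnitAddCircle.measure_univ⟩⟩

theorem tendsto_empirical_rotation {ρ : ℝ} (hρ : Irrational ρ) (c : ℝ) :
    Tendsto (fun n : ℕ => empirical (fun i : ℕ => ((i * ρ + c : ℝ) : UnitAddCircle)) (n + 1))
      atTop (𝓝 circleVolume) := by
  rw [ProbabilityMeasure.tendsto_iff_forall_integral_tendsto]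
  intro f
  let F : C(UnitAddCircle, ℂ) := ⟨fun t => (f t : ℂ), by fun_prop⟩
  have h := (tendsto_add_atTop_iff_nat 1).2 (tendsto_average_rotation hρ c F)
  have h' := (Complex.continuous_re.tendsto _).comp h
  have e : (∫ t, F t).re = ∫ t, f t ∂(circleVolume : Measure UnitAddCircle) := by
    change (∫ t, ((f t : ℝ) : ℂ)).re = _
    rw [show ∫ t : UnitAddCircle, ((f t : ℝ) : ℂ) = ((∫ t : UnitAddCircle, f t : ℝ) : ℂ) from
      integral_ofReal]
    rfl
  rw [e] at h'
  refine h'.congr fun n => ?_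
  rw [integral_empirical]
  simp only [Function.comp, F, ContinuousMap.coe_mk, Complex.smul_re, Complex.re_sum,
    Complex.ofReal_re]

theorem measurable_fMinus (a b : ℝ) : Measurable (fMinus a b) := by
  unfold fMinus
  fun_prop

theorem measurable_fPlus (a b : ℝ) : Measurable (fPlus a b) := by
  unfold fPlus
  fun_prop

theorem empirical_shift {X : Type*} [MeasurableSpace X] {y : ℕ → X} {q : ℕ} [NeZero q]
    (hy : ∀ n, y (n + q) = y n) (j : ℕ) : empirical (fun n => y (j + n)) q = empirical y q := by
  induction j with
  | zero => simp
  | succ j ih =>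
    rw [← ih]
    apply Subtype.ext
    simp only [empirical]
    congr 1
    obtain ⟨q, rfl⟩ := Nat.exists_eq_succ_of_ne_zero (NeZero.ne q)
    rw [Finset.sum_range_succ, Finset.sum_range_succ',
      show j + 1 + q = j + 0 + q.succ by simp; ring, hy]
    simp only [add_assoc, add_comm 1]

theorem uniformOn_image_eq_empirical {y : ℕ → ℝ} {q : ℕ} [NeZero q]
    (hy : Set.InjOn y (Set.Iio q)) :
    uniformOn (y '' Set.Iio q) = (empirical y q : Measure ℝ) := by
  classical
  have hy' : Set.InjOn y (Finset.range q : Finset ℕ) := by simpa using hy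
  have hC : y '' Set.Iio q = ((Finset.range q).image y : Finset ℝ) := by simp
  ext s hs
  have hCs : (((Finset.range q).image y : Finset ℝ) : Set ℝ) ∩ s =
      (((Finset.range q).image y).filter (· ∈ s) : Finset ℝ) := by
    ext t; simp
  rw [hC, uniformOn, cond_apply (Finset.measurableSet _), hCs, Measure.count_apply_finset,
    Measure.count_apply_finset, Finset.card_image_of_injOn hy', Finset.card_range,
    Finset.card_filter, Finset.sum_image hy']
  simp [empirical, Measure.dirac_apply' _ hs, Set.indicator_apply]

/-! ### Irrational rotation number. -/

section Irrational

/-- The function on the circle induced by the restriction of `φ_ρ` to `[0, 1)`. -/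
noncomputable def phiCircle (a b ρ : ℝ) (t : UnitAddCircle) : ℝ :=
  phi a b ρ (AddCircle.equivIco 1 0 t)

variable {a b ρ : ℝ}

theorem phiCircle_coe (x : ℝ) : phiCircle a b ρ x = phi a b ρ (Int.fract x) := by
  rw [phiCircle, AddCircle.coe_equivIco_mk_apply]
  simp

theorem measurable_phiCircle (ha0 : 0 < a) (ha1 : a < 1) : Measurable (phiCircle a b ρ) :=
  (phi_monotone ha0 ha1 ρ).measurable.comp
    (measurable_subtype_coe.comp (AddCircle.measurableEquivIco 1 0).measurable)

theorem volume_eq_zero_of_countable {s : Set UnitAddCircle} (hs : s.Countable) : volume s = 0 := by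
  rw [← Set.biUnion_of_singleton s, measure_biUnion_null_iff hs]
  intro t _
  rw [← Metric.closedBall_zero, AddCircle.volume_closedBall]
  simp

/-- A monotone function has countably many discontinuities; wrapping onto the circle adds at most
the point 0. -/
theorem ae_continuousAt_phiCircle (ha0 : 0 < a) (ha1 : a < 1) :
    ∀ᵐ t : UnitAddCircle, ContinuousAt (phiCircle a b ρ) t := by
  have hD := (phi_monotone (b := b) ha0 ha1 ρ).countable_not_continuousAt
  have hnull : volume (((↑) '' {x | ¬ContinuousAt (phi a b ρ) x} ∪ {0} : Set UnitAddCircle)) = 0 :=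
    volume_eq_zero_of_countable ((hD.image _).union (Set.countable_singleton _))
  filter_upwards [measure_eq_zero_iff_ae_notMem.1 hnull] with t ht
  simp only [Set.union_singleton, Set.mem_insert_iff, Set.mem_image, Set.mem_ofPred_eq, not_or,
    not_exists, not_and] at ht
  have h1 : ContinuousAt (phi a b ρ) (AddCircle.equivIco 1 0 t) := by
    by_contra hc
    exact ht.2 _ hc AddCircle.coe_equivIco
  exact ContinuousAt.comp (g := phi a b ρ) h1
    (continuousAt_subtype_val.comp (AddCircle.continuousAt_equivIco 1 0 ht.1))

theorem map_phiCircle (ha0 : 0 < a) (ha1 : a < 1) :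
    Measure.map (phiCircle a b ρ) volume =
      Measure.map (phi a b ρ) ((volume : Measure ℝ).restrict (Set.Icc (0 : ℝ) 1)) := by
  have h := UnitAddCircle.measurePreserving_mk 0
  rw [zero_add] at h
  rw [← h.map_eq, Measure.map_map (measurable_phiCircle ha0 ha1) h.measurable,
    Measure.restrict_congr_set (Ioc_ae_eq_Icc (α := ℝ)),
    ← Measure.restrict_congr_set (Ico_ae_eq_Icc (α := ℝ))]
  refine Measure.map_congr ?_
  filter_upwards [ae_restrict_mem measurableSet_Ico] with x hx
  rw [Function.comp, phiCircle_coe, Int.fract_eq_self.2 hx]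

theorem phi_strictMono (ha0 : 0 < a) (ha1 : a < 1) (hρ : Irrational ρ) :
    StrictMono (phi a b ρ) := by
  intro s t hst
  have hd : DenseRange (fun n : ℕ => n • (ρ : UnitAddCircle)) :=
    denseRange_zsmul_iff_nsmul.1 (AddCircle.denseRange_zsmul_coe_iff.2 (by simpa using hρ))
  have hU : IsOpen (((↑) : ℝ → UnitAddCircle) '' Set.Ioo (s - ρ) (t - ρ)) :=
    QuotientAddGroup.isOpenMap_coe _ isOpen_Ioo
  -- Some `n * ρ` falls in `(s - ρ, t - ρ)` modulo 1, so the `n`-th summand jumps between `s` and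
  -- `t`.
  obtain ⟨n, u, hu, hn⟩ := hd.exists_mem_open hU
    ((Set.nonempty_Ioo.2 (by linarith)).image _)
  have hm : ((u - n * ρ : ℝ) : UnitAddCircle) = 0 := by
    rw [AddCircle.coe_sub, hn, ← nsmul_eq_mul, AddCircle.coe_nsmul, sub_self]
  obtain ⟨m, hm⟩ := (AddCircle.coe_eq_zero_iff 1).1 hm
  rw [zsmul_eq_mul, mul_one] at hm
  exact phi_lt_phi ha0 ha1 n m (by linarith [hu.1]) (by linarith [hu.2])

/-- The push-forward of Lebesgue measure under `φ_ρ`. -/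
noncomputable def phiMeasure (b ρ : ℝ) (ha0 : 0 < a) (ha1 : a < 1) : ProbabilityMeasure ℝ :=
  circleVolume.map (measurable_phiCircle (b := b) (ρ := ρ) ha0 ha1).aemeasurable

theorem coe_phiMeasure (ha0 : 0 < a) (ha1 : a < 1) :
    (phiMeasure b ρ ha0 ha1 : Measure ℝ) = Measure.map (phiCircle a b ρ) volume := rfl

theorem IsOrbit.tendsto_empirical_phiMeasure (ha0 : 0 < a) (ha1 : a < 1)
    (hρ : Irrational (liftMinusLift b ha0 ha1).translationNumber) {x : ℕ → ℝ}
    (hx : IsOrbit a b x) :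
    Tendsto (fun n : ℕ => empirical x (n + 1)) atTop
      (𝓝 (phiMeasure b (liftMinusLift b ha0 ha1).translationNumber ha0 ha1)) := by
  obtain ⟨k, hk⟩ := hx.exists_isCoding
  obtain ⟨c, hc⟩ := hk.exists_shift ha0 ha1
  obtain ⟨N, hN⟩ := IsCoding.eventually_eq_floor_of_irrational hρ hc
  refine tendsto_empirical_of_tendsto_sub (hk.tendsto_sub_phi ha0 ha1 hN) ?_
  refine (tendsto_map_of_ae_continuousAt (tendsto_empirical_rotation hρ c)
    (measurable_phiCircle (b := b) ha0 ha1) (ae_continuousAt_phiCircle ha0 ha1)).congr fun n => ?_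
  rw [map_empirical _ _ (measurable_phiCircle ha0 ha1)]
  congr 1
  ext i
  exact phiCircle_coe _

/-- The measure is a weak limit of empirical measures of a genuine orbit, hence carried by `[0, 1]`;
injectivity makes the values 0 and 1 negligible. -/
theorem ae_phiCircle_mem_Ioo (ha0 : 0 < a) (ha1 : a < 1)
    (hρ : Irrational (liftMinusLift b ha0 ha1).translationNumber) :
    ∀ᵐ t : UnitAddCircle,
      phiCircle a b (liftMinusLift b ha0 ha1).translationNumber t ∈ Set.Ioo (0 : ℝ) 1 := by
  set ρ := (liftMinusLift b ha0 ha1).translationNumber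
  obtain ⟨x, hx⟩ := exists_isOrbit a b
  obtain ⟨k, hk⟩ := hx.exists_isCoding
  have h0 : (phiMeasure b ρ ha0 ha1 : Measure ℝ) (Set.Icc (0 : ℝ) 1)ᶜ = 0 := by
    have h := ProbabilityMeasure.le_liminf_measure_open_of_tendsto
      (hx.tendsto_empirical_phiMeasure ha0 ha1 hρ) (isClosed_Icc (a := (0 : ℝ)) (b := 1)).isOpen_compl
    have hz : ∀ n : ℕ, (empirical x (n + 1) : Measure ℝ) (Set.Icc (0 : ℝ) 1)ᶜ = 0 := by
      intro n
      have hx' : ∀ i, x i ∉ (Set.Icc (0 : ℝ) 1)ᶜ := fun i => not_not.2 (hk.mem i)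
      simp [empirical, Measure.dirac_apply' _ measurableSet_Icc.compl, Set.indicator_of_notMem (hx' _),
        -Set.mem_compl_iff]
    simpa [hz] using h
  rw [coe_phiMeasure, Measure.map_apply (measurable_phiCircle ha0 ha1) measurableSet_Icc.compl] at h0
  have hinj : Function.Injective (phiCircle a b ρ) := fun s t hst =>
    (AddCircle.equivIco 1 0).injective (Subtype.ext ((phi_strictMono ha0 ha1 hρ).injective hst))
  have hpt : ∀ v : ℝ, ∀ᵐ t : UnitAddCircle, phiCircle a b ρ t ≠ v := fun v =>
    measure_eq_zero_iff_ae_notMem.1 (volume_eq_zero_of_countable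
      ((Set.subsingleton_singleton (a := v)).preimage hinj).countable)
  filter_upwards [measure_eq_zero_iff_ae_notMem.1 h0, hpt 0, hpt 1] with t h1 h2 h3
  have h1' := not_not.1 h1
  exact ⟨lt_of_le_of_ne h1'.1 h2.symm, lt_of_le_of_ne h1'.2 h3⟩

/-- Almost everywhere `f ∘ φ_ρ` equals `φ_ρ` after the rotation, which preserves Lebesgue measure.
The hypothesis `h` covers both branches, which agree when the value is interior. -/
theorem measurePreserving_phiMeasure (ha0 : 0 < a) (ha1 : a < 1)
    (hρ : Irrational (liftMinusLift b ha0 ha1).translationNumber) {f : ℝ → ℝ} (hf : Measurable f)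
    (h : ∀ (x u : ℝ) (d : ℤ), u = a * x + b - d → u ∈ Set.Ioo (0 : ℝ) 1 → u = f x) :
    MeasurePreserving f
      (phiMeasure b (liftMinusLift b ha0 ha1).translationNumber ha0 ha1 : Measure ℝ)
      (phiMeasure b (liftMinusLift b ha0 ha1).translationNumber ha0 ha1 : Measure ℝ) := by
  set ρ := (liftMinusLift b ha0 ha1).translationNumber
  have hΦ := measurable_phiCircle (b := b) (ρ := ρ) ha0 ha1
  have hrot := measurePreserving_add_right (volume : Measure UnitAddCircle) (ρ : UnitAddCircle)
  refine ⟨hf, ?_⟩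
  rw [coe_phiMeasure, Measure.map_map hf hΦ]
  conv_rhs => rw [← hrot.map_eq, Measure.map_map hΦ hrot.measurable]
  refine Measure.map_congr ?_
  filter_upwards [hrot.quasiMeasurePreserving.ae (ae_phiCircle_mem_Ioo ha0 ha1 hρ)] with t ht
  obtain ⟨s, rfl⟩ := QuotientAddGroup.mk_surjective t
  obtain ⟨d, hd⟩ := exists_phi_fract_add_rotation (b := b) ha0 ha1 ρ s
  rw [← phiCircle_coe, ← phiCircle_coe] at hd
  exact (h _ _ d hd ht).symm

end Irrational

/-! ### Rational rotation number and the limit cycle. -/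

section Rational

/-- The periodic orbit of `f_±` with rotation number `p / q`. -/
noncomputable def cycle (a b : ℝ) (p : ℤ) (q n : ℕ) : ℝ := phi a b (p / q) (Int.fract (n * (p / q)))

variable {a b : ℝ} {p : ℤ} {q : ℕ}

theorem cycle_eq (n : ℕ) : cycle a b p q n = phi a b (p / q) (((n * p % q : ℤ) : ℝ) / q) := by
  rw [cycle, mul_div_assoc', show (n : ℝ) * p / q = ((n * p : ℤ) : ℝ) / q by push_cast; rfl,
    Int.fract_div_intCast_eq_div_intCast_mod]

theorem cycle_add_period (n : ℕ) : cycle a b p q (n + q) = cycle a b p q n := by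
  rw [cycle_eq, cycle_eq]
  push_cast
  rw [add_mul, Int.add_mul_emod_self_left]

theorem cycle_injOn (ha0 : 0 < a) (ha1 : a < 1) (hq : 0 < q) (hpq : IsCoprime p (q : ℤ)) :
    Set.InjOn (cycle a b p q) (Set.Iio q) := by
  intro i hi j hj hij
  rw [cycle_eq, cycle_eq] at hij
  have h1 : (i * p % q : ℤ) = j * p % q := by
    rcases lt_trichotomy (i * p % q : ℤ) (j * p % q) with h | h | h
    · exact absurd hij (phi_lt_phi_of_coprime ha0 ha1 hq hpq h).ne
    · exact h
    · exact absurd hij (phi_lt_phi_of_coprime ha0 ha1 hq hpq h).ne'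
  have h2 : (q : ℤ) ∣ (j - i) * p := by
    rw [sub_mul]; exact (Int.ModEq.dvd h1)
  have h3 := hpq.symm.dvd_of_dvd_mul_right h2
  have h4 := Int.emod_eq_emod_iff_emod_sub_eq_zero.2 (Int.emod_eq_zero_of_dvd h3)
  rw [Int.emod_eq_of_lt (by omega) (by exact_mod_cast hj),
    Int.emod_eq_of_lt (by omega) (by exact_mod_cast hi)] at h4
  exact_mod_cast h4.symm

/-- All points are values of `φ_ρ` on `[0, 1)` at multiples of `1 / q`, and `φ_ρ 1 = φ_ρ 0 + 1`.
This keeps 0 and 1 from both lying on the cycle. -/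
theorem cycle_lt_add_one (ha0 : 0 < a) (ha1 : a < 1) (hq : 0 < q) (hpq : IsCoprime p (q : ℤ))
    (i j : ℕ) : cycle a b p q i < cycle a b p q j + 1 := by
  have hqz : (0 : ℤ) < q := by exact_mod_cast hq
  have hq' : (q : ℝ) ≠ 0 := by exact_mod_cast hq.ne'
  rw [cycle_eq, cycle_eq]
  calc phi a b (p / q) (((i * p % q : ℤ) : ℝ) / q) < phi a b (p / q) (((q : ℤ) : ℝ) / q) :=
        phi_lt_phi_of_coprime ha0 ha1 hq hpq (Int.emod_lt_of_pos _ hqz)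
    _ = phi a b (p / q) 0 + 1 := by
        have := phi_add_intCast (b := b) ha0 ha1 (p / q) 0 1
        rw [Int.cast_natCast, div_self hq']
        simpa using this
    _ ≤ _ := by
        gcongr
        refine phi_monotone ha0 ha1 _ (div_nonneg ?_ (by positivity))
        exact_mod_cast Int.emod_nonneg _ hqz.ne'

theorem exists_cycle_succ (ha0 : 0 < a) (ha1 : a < 1) (n : ℕ) :
    ∃ d : ℤ, cycle a b p q (n + 1) = a * cycle a b p q n + b - d := by
  obtain ⟨d, hd⟩ := exists_phi_fract_add_rotation (b := b) ha0 ha1 (p / q) (n * (p / q))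
  refine ⟨d, ?_⟩
  rw [cycle, cycle, ← hd]
  congr 2
  push_cast
  ring

theorem exists_fract_shift (hq : 0 < q) (hpq : IsCoprime p (q : ℤ)) (r : ℤ) :
    ∃ j : ℕ, ∀ n : ℕ, Int.fract ((n : ℝ) * (p / q) + r / q) =
      Int.fract (((j + n : ℕ) : ℝ) * (p / q)) := by
  have hq' : (q : ℝ) ≠ 0 := by exact_mod_cast hq.ne'
  have hqz : (0 : ℤ) < q := by exact_mod_cast hq
  obtain ⟨u, v, huv⟩ := hpq
  -- `u` inverts `p` modulo `q`, so `j * p ≡ r`.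
  obtain ⟨j, hj⟩ := Int.eq_ofNat_of_zero_le (Int.emod_nonneg (u * r) hqz.ne')
  refine ⟨j, fun n => Int.fract_eq_fract.2 ⟨v * r + u * r / q * p, ?_⟩⟩
  have hd : r - (j : ℤ) * p = q * (v * r + u * r / q * p) := by
    have := Int.emod_add_mul_ediv (u * r) q
    rw [hj] at this
    linear_combination -p * this - r * huv
  have hd' : (r : ℝ) - j * p = q * ((v * r + u * r / q * p : ℤ) : ℝ) := by exact_mod_cast hd
  rw [← mul_left_cancel_iff_of_pos (show (0 : ℝ) < q by exact_mod_cast hq), ← hd']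
  push_cast
  field_simp
  ring

theorem IsOrbit.exists_tendsto_sub_cycle (ha0 : 0 < a) (ha1 : a < 1) (hq : 0 < q)
    (hpq : IsCoprime p (q : ℤ)) (hρ : (liftMinusLift b ha0 ha1).translationNumber = p / q)
    {x : ℕ → ℝ} (hx : IsOrbit a b x) :
    ∃ j : ℕ, Tendsto (fun n => x n - cycle a b p q (j + n)) atTop (𝓝 0) := by
  obtain ⟨k, hk⟩ := hx.exists_isCoding
  obtain ⟨c, hc⟩ := hk.exists_shift ha0 ha1
  rw [hρ] at hc
  obtain ⟨r, N, hN⟩ := hk.eventually_eq_floor_of_rational ha0 ha1 hq hpq hc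
  obtain ⟨j, hj⟩ := exists_fract_shift hq hpq r
  refine ⟨j, (hk.tendsto_sub_phi ha0 ha1 hN).congr fun n => ?_⟩
  rw [hj, cycle]

/-- Each point of the cycle is a limit of points of an actual orbit, which stays in `[0, 1]`. -/
theorem cycle_mem_Icc (ha0 : 0 < a) (ha1 : a < 1) (hq : 0 < q)
    (hpq : IsCoprime p (q : ℤ)) (hρ : (liftMinusLift b ha0 ha1).translationNumber = p / q) (n : ℕ) :
    cycle a b p q n ∈ Set.Icc (0 : ℝ) 1 := by
  obtain ⟨x, hx⟩ := exists_isOrbit a b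
  obtain ⟨j, hj⟩ := hx.exists_tendsto_sub_cycle ha0 ha1 hq hpq hρ
  obtain ⟨k, hk⟩ := hx.exists_isCoding
  -- `i` completes the shift `j` to the multiple `q * j` of the period.
  obtain ⟨i, hi⟩ := Nat.exists_eq_add_of_le (Nat.le_mul_of_pos_left j hq)
  have hper : Function.Periodic (cycle a b p q) q := cycle_add_period
  have hsub : Tendsto (fun s : ℕ => n + i + s * q) atTop atTop :=
    tendsto_atTop_mono (fun s => (Nat.le_mul_of_pos_right s hq).trans (Nat.le_add_left _ _))
      tendsto_id
  have h1 : Tendsto (fun s : ℕ => x (n + i + s * q)) atTop (𝓝 (cycle a b p q n)) := by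
    have h2 := (hj.comp hsub).add_const (cycle a b p q n)
    rw [zero_add] at h2
    refine h2.congr fun s => ?_
    have : cycle a b p q (j + (n + i + s * q)) = cycle a b p q n := by
      rw [show j + (n + i + s * q) = n + (j + s) * q by rw [add_mul, mul_comm j q, hi]; ring]
      exact hper.nat_mul (j + s) n
    simp [this]
  exact isClosed_Icc.mem_of_tendsto h1 (Eventually.of_forall fun s => hk.mem _)

theorem measurePreserving_empirical_cycle [NeZero q] {f : ℝ → ℝ} (hf : Measurable f)
    (h : ∀ n, cycle a b p q (n + 1) = f (cycle a b p q n)) :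
    MeasurePreserving f (empirical (cycle a b p q) q : Measure ℝ)
      (empirical (cycle a b p q) q : Measure ℝ) := by
  refine ⟨hf, ?_⟩
  rw [← ProbabilityMeasure.toMeasure_map _ hf.aemeasurable, map_empirical _ _ hf,
    ← empirical_shift (cycle_add_period (a := a) (b := b) (p := p)) 1]
  congr 2
  ext n
  rw [Function.comp, ← h, add_comm]

end Rational

/-! ### Assembly of the two cases. -/

theorem theorem9p1 (a b : ℝ) (ha0 : 0 < a) (ha1 : a < 1) (hb0 : 0 ≤ b) (hb1 : b < 1) :
    ∃ ρ : ℝ, IsRotationNumber a b ρ ∧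
      ∃ μ : ProbabilityMeasure ℝ,
        (¬ Irrational ρ →
          ∃ C : Set ℝ, IsUniversalLimitCycle a b C ∧
            (μ : Measure ℝ) = uniformOn C ∧
            ((0 : ℝ) ∉ C ∨ (1 : ℝ) ∉ C) ∧
            ((1 : ℝ) ∉ C → MeasurePreserving (fMinus a b) (μ : Measure ℝ) (μ : Measure ℝ)) ∧
            ((0 : ℝ) ∉ C → MeasurePreserving (fPlus a b) (μ : Measure ℝ) (μ : Measure ℝ))) ∧
        (Irrational ρ →
          (μ : Measure ℝ) =
            Measure.map (phi a b ρ) ((volume : Measure ℝ).restrict (Set.Icc (0 : ℝ) 1)) ∧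
          MeasurePreserving (fMinus a b) (μ : Measure ℝ) (μ : Measure ℝ) ∧
          MeasurePreserving (fPlus a b) (μ : Measure ℝ) (μ : Measure ℝ)) ∧
        ∀ x : ℕ → ℝ, IsOrbit a b x →
          Tendsto (fun n : ℕ => empiricalMeasure x (n + 1)) atTop (𝓝 μ) := by
  refine ⟨_, isRotationNumber_translationNumber ha0 ha1 hb0 hb1, ?_⟩
  by_cases hρ : Irrational (liftMinusLift b ha0 ha1).translationNumber
  · refine ⟨phiMeasure b _ ha0 ha1, fun h => absurd hρ h, fun _ => ⟨map_phiCircle ha0 ha1, ?_, ?_⟩,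
      fun x hx => hx.tendsto_empirical_phiMeasure ha0 ha1 hρ⟩
    · exact measurePreserving_phiMeasure ha0 ha1 hρ (measurable_fMinus a b)
        fun x u d h hu => eq_fMinus h (Set.Ioo_subset_Ico_self hu)
    · exact measurePreserving_phiMeasure ha0 ha1 hρ (measurable_fPlus a b)
        fun x u d h hu => eq_fPlus h (Set.Ioo_subset_Ioc_self hu)
  · obtain ⟨r, hr⟩ : ∃ r : ℚ, (r : ℝ) = (liftMinusLift b ha0 ha1).translationNumber :=
      not_not.1 hρ
    obtain ⟨p, q, hq, hpq, hpr⟩ : ∃ (p : ℤ) (q : ℕ), 0 < q ∧ IsCoprime p (q : ℤ) ∧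
        (liftMinusLift b ha0 ha1).translationNumber = p / q :=
      ⟨r.num, r.den, r.den_pos, Rat.isCoprime_num_den r, by rw [← hr, Rat.cast_def]⟩
    have : NeZero q := ⟨hq.ne'⟩
    have hper := cycle_add_period (a := a) (b := b) (p := p) (q := q)
    have hmem := cycle_mem_Icc ha0 ha1 hq hpq hpr
    have hC : ∀ n, cycle a b p q n ∈ cycle a b p q '' Set.Iio q := fun n =>
      ⟨n % q, Nat.mod_lt n hq, Function.Periodic.map_mod_nat hper n⟩
    refine ⟨empirical (cycle a b p q) q, fun _ => ⟨cycle a b p q '' Set.Iio q,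
      ⟨q, cycle a b p q, ⟨⟨hmem 0, fun n => ?_⟩, hq, hper⟩, rfl,
        fun x hx => hx.exists_tendsto_sub_cycle ha0 ha1 hq hpq hpr⟩,
      (uniformOn_image_eq_empirical (cycle_injOn ha0 ha1 hq hpq)).symm, ?_, fun h1 => ?_,
      fun h0 => ?_⟩, fun h => absurd h hρ, fun x hx => ?_⟩
    · obtain ⟨d, hd⟩ := exists_cycle_succ (b := b) (p := p) (q := q) ha0 ha1 n
      exact mem_fPM hd (hmem _)
    · by_contra! h
      obtain ⟨⟨i, -, hi⟩, ⟨j, -, hj⟩⟩ := h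
      have := cycle_lt_add_one (b := b) ha0 ha1 hq hpq j i
      rw [hi, hj] at this
      linarith
    · refine measurePreserving_empirical_cycle (measurable_fMinus a b) fun n => ?_
      obtain ⟨d, hd⟩ := exists_cycle_succ (b := b) (p := p) (q := q) ha0 ha1 n
      exact eq_fMinus hd ⟨(hmem _).1, lt_of_le_of_ne (hmem _).2 fun h => h1 (h ▸ hC _)⟩
    · refine measurePreserving_empirical_cycle (measurable_fPlus a b) fun n => ?_
      obtain ⟨d, hd⟩ := exists_cycle_succ (b := b) (p := p) (q := q) ha0 ha1 n
      exact eq_fPlus hd ⟨lt_of_le_of_ne (hmem _).1 fun h => h0 (h ▸ hC _), (hmem _).2⟩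
    · obtain ⟨j, hj⟩ := hx.exists_tendsto_sub_cycle ha0 ha1 hq hpq hpr
      have h := tendsto_empirical_of_periodic (y := fun n => cycle a b p q (j + n)) (q := q)
        fun n => by rw [← add_assoc, hper]
      rw [empirical_shift hper] at h
      exact tendsto_empirical_of_tendsto_sub hj h
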